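/- For a set $K\subseteq\mathbb R$ of admissible data, consider the following families of subsets of the spaces $\mathbb R^n$, $n\ge 0$, in which all entries of the vectors and matrices that occur lie in $K$. - $\mathscr T^{CBL}(K)$ (continuous bilevel linear sets): the sets of all $(x,y)\in\mathbb R^{n_\ell+n_f}$ with $Ax+By\le b$ and $y\in\arg\max_{y'}\{f^\top y' : Dy'\le g-Cx\}$. - $\mathscr T^{LC}(K)$ (linear complementarity sets): the sets $\{x\in\mathbb R^n : x\ge 0,\ Mx+q\ge 0,\ x^\top(Mx+q)=0,\ Ax\le b\}$. - $\mathscr T^{PRC}(K)$ (polyhedral reverse-convex sets): the sets $\{x\in\mathbb R^n : Ax\le b,\ f_i(x)\ge 0 \text{ for } i=1,\dots,n'\}$, where $n'\ge 0$ and each $f_i$ is a maximum of finitely many (at least one) affine functions $x\mapsto\langle\alpha,x\rangle-\beta$. - $\mathscr P(K)$: the finite unions of polyhedra $\{x\in\mathbb R^n : Ax\le b\}$. Further, let $\mathscr T^{MI}(K)$ be the family of the mixed-integer sets $\{x\in\mathbb R^n : Ax\le b,\ x_i\in\mathbb Z \text{ for } i\in I\}$, where $I\subseteq\{1,\dots,n\}$,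 the matrix $A$ is rational and the entries of $b$ lie in $K$. For a family $\mathscr T(K)$ let $\mathscr T_R(K)$ be the family of the images of its members under the linear maps $\mathbb R^m\to\mathbb R^n$ given by matrices with entries in $K$ (the sets representable by $\mathscr T(K)$), and let a bar denote the subfamily of bounded sets. Then, both for $K=\mathbb R$ and for $K=\mathbb Q$, $$\overline{\mathscr T^{CBL}_R(K)}=\overline{\mathscr T^{LC}_R(K)}=\overline{\mathscr T^{PRC}_R(K)}=\overline{\mathscr P(K)}=\overline{\mathscr T^{MI}_R(K)} .$$ -/

import Mathlib

open scoped Matrix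

namespace Representability

/-- A family of subsets of the spaces `ℝⁿ`; its members may live in different dimensions `n`. -/
abbrev SetFamily : Type := (n : ℕ) → Set (Set (Fin n → ℝ))

/-- The subfamily of the bounded members of `T`. -/
def SetFamily.bounded (T : SetFamily) : SetFamily :=
  fun n => {S | S ∈ T n ∧ Bornology.IsBounded S}

/-- The sets representable by `T`: the images of members of `T` under linear maps. Only linear maps
given by a matrix with entries in `K` are used (`K = Set.univ`: all linear maps). -/
def SetFamily.representable (K : Set ℝ) (T : SetFamily) : SetFamily :=
  fun n => {S | ∃ (m : ℕ) (T₀ : Set (Fin m → ℝ)) (L : Matrix (Fin n) (Fin m) ℝ),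
    T₀ ∈ T m ∧ (∀ i j, L i j ∈ K) ∧ S = (fun x => L *ᵥ x) '' T₀}

/-- The rational numbers, as a set of real numbers. -/
def rationals : Set ℝ := Set.range ((↑) : ℚ → ℝ)

/-- The real number `t` is an integer. -/
def IsInt (t : ℝ) : Prop := ∃ z : ℤ, t = (z : ℝ)

/-! In all the families below, `K` is the set from which the data are taken:
`K = Set.univ` for real data, `K = rationals` for rational data. -/

/-- The polyhedron `{x : A x ≤ b}`. -/
def polyhedron {m n : ℕ} (A : Matrix (Fin m) (Fin n) ℝ) (b : Fin m → ℝ) : Set (Fin n → ℝ) :=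
  {x | A *ᵥ x ≤ b}

/-- Polyhedra. -/
def polyhedra (K : Set ℝ) : SetFamily :=
  fun n => {S | ∃ (m : ℕ) (A : Matrix (Fin m) (Fin n) ℝ) (b : Fin m → ℝ),
    (∀ i j, A i j ∈ K) ∧ (∀ i, b i ∈ K) ∧ S = polyhedron A b}

/-- Finite unions of polyhedra. -/
def polyhedralUnions (K : Set ℝ) : SetFamily :=
  fun n => {S | ∃ (k : ℕ) (P : Fin k → Set (Fin n → ℝ)),
    (∀ i, P i ∈ polyhedra K n) ∧ S = ⋃ i, P i}

/-- Mixed-integer sets: the points of a polyhedron `{x : A x ≤ b}` whose coordinates with index in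
`I` are integers. The entries of `A` are taken from `K` and those of `b` from `K'`. -/
def mixedIntegerSets (K K' : Set ℝ) : SetFamily :=
  fun n => {S | ∃ (m : ℕ) (A : Matrix (Fin m) (Fin n) ℝ) (b : Fin m → ℝ) (I : Set (Fin n)),
    (∀ i j, A i j ∈ K) ∧ (∀ i, b i ∈ K') ∧
    S = {x | x ∈ polyhedron A b ∧ ∀ i ∈ I, IsInt (x i)}}

/-- `y` is an optimal solution of
`max {fᵀ y : D y ≤ g - C x, y i ∈ ℤ for i ∈ IF}`, the lower-level problem at `x`. -/
def IsLowerOptimal {nl nf mf : ℕ} (f : Fin nf → ℝ) (C : Matrix (Fin mf) (Fin nl) ℝ)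
    (D : Matrix (Fin mf) (Fin nf) ℝ) (g : Fin mf → ℝ) (IF : Set (Fin nf))
    (x : Fin nl → ℝ) (y : Fin nf → ℝ) : Prop :=
  (D *ᵥ y ≤ g - C *ᵥ x ∧ ∀ i ∈ IF, IsInt (y i)) ∧
  ∀ y' : Fin nf → ℝ, D *ᵥ y' ≤ g - C *ᵥ x → (∀ i ∈ IF, IsInt (y' i)) → f ⬝ᵥ y' ≤ f ⬝ᵥ y

/-- `(x, y)` lies in the mixed-integer bilevel linear set with the given data. -/
def InBilevelSet {nl nf ml mf : ℕ} (A : Matrix (Fin ml) (Fin nl) ℝ)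
    (B : Matrix (Fin ml) (Fin nf) ℝ) (b : Fin ml → ℝ) (f : Fin nf → ℝ)
    (C : Matrix (Fin mf) (Fin nl) ℝ) (D : Matrix (Fin mf) (Fin nf) ℝ) (g : Fin mf → ℝ)
    (IL : Set (Fin nl)) (IF : Set (Fin nf)) (x : Fin nl → ℝ) (y : Fin nf → ℝ) : Prop :=
  A *ᵥ x + B *ᵥ y ≤ b ∧ IsLowerOptimal f C D g IF x y ∧ ∀ i ∈ IL, IsInt (x i)

/-- Continuous bilevel linear (CBL) sets in `ℝⁿ`, `n = nl + nf`: the first `nl` coordinates form the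
leader's vector `x`, the last `nf` the follower's vector `y`, and no variable is integer. -/
def cblSets (K : Set ℝ) : SetFamily :=
  fun n => {S | ∃ (nl nf ml mf : ℕ) (h : nl + nf = n) (A : Matrix (Fin ml) (Fin nl) ℝ)
    (B : Matrix (Fin ml) (Fin nf) ℝ) (b : Fin ml → ℝ) (f : Fin nf → ℝ)
    (C : Matrix (Fin mf) (Fin nl) ℝ) (D : Matrix (Fin mf) (Fin nf) ℝ) (g : Fin mf → ℝ),
    (∀ i j, A i j ∈ K) ∧ (∀ i j, B i j ∈ K) ∧ (∀ i, b i ∈ K) ∧ (∀ i, f i ∈ K) ∧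
    (∀ i j, C i j ∈ K) ∧ (∀ i j, D i j ∈ K) ∧ (∀ i, g i ∈ K) ∧
    S = {z | InBilevelSet A B b f C D g ∅ ∅
      (fun i => z (Fin.cast h (Fin.castAdd nf i))) (fun i => z (Fin.cast h (Fin.natAdd nl i)))}}

/-- Linear complementarity (LC) sets. -/
def lcSets (K : Set ℝ) : SetFamily :=
  fun n => {S | ∃ (m : ℕ) (M : Matrix (Fin n) (Fin n) ℝ) (q : Fin n → ℝ)
    (A : Matrix (Fin m) (Fin n) ℝ) (b : Fin m → ℝ),
    (∀ i j, M i j ∈ K) ∧ (∀ i, q i ∈ K) ∧ (∀ i j, A i j ∈ K) ∧ (∀ i, b i ∈ K) ∧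
    S = {x | 0 ≤ x ∧ 0 ≤ M *ᵥ x + q ∧ x ⬝ᵥ (M *ᵥ x + q) = 0 ∧ A *ᵥ x ≤ b}}

/-- Polyhedral convex functions: `f x = max_j (⟨α j, x⟩ - β j)`, a maximum of finitely many affine
functions (at least one, since the maximum is attained). -/
def IsPolyhedralConvex (K : Set ℝ) {n : ℕ} (f : (Fin n → ℝ) → ℝ) : Prop :=
  ∃ (k : ℕ) (α : Fin k → Fin n → ℝ) (β : Fin k → ℝ),
    (∀ j i, α j i ∈ K) ∧ (∀ j, β j ∈ K) ∧
    ∀ x, IsGreatest (Set.range fun j => α j ⬝ᵥ x - β j) (f x)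

/-- Polyhedral reverse-convex (PRC) sets. -/
def prcSets (K : Set ℝ) : SetFamily :=
  fun n => {S | ∃ (n' m : ℕ) (A : Matrix (Fin m) (Fin n) ℝ) (b : Fin m → ℝ)
    (f : Fin n' → (Fin n → ℝ) → ℝ),
    (∀ i j, A i j ∈ K) ∧ (∀ i, b i ∈ K) ∧ (∀ i, IsPolyhedralConvex K (f i)) ∧
    S = {x | A *ᵥ x ≤ b ∧ ∀ i, 0 ≤ f i x}}

end Representability

open Representability

namespace Representability

/-! Working over a subfield `K` of the reals treats both cases at once: `⊤` gives real data, `⊥`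
gives rational data. Every family is compared with the finite unions of polyhedra.

Upper bounds. A CBL, LC or PRC set is a finite union of polyhedra: one guesses, respectively, a set
of tight follower constraints certifying optimality, which factor of each complementary product
vanishes, or which affine piece of each maximum is nonnegative. Fourier–Motzkin elimination shows
that linear images of polyhedra are polyhedra, so representable sets are finite unions too;
boundedness is not needed here. For mixed-integer sets it is. Since the matrix is rational, the
recession cone has integral generators, and integer multiples of these can be added without leaving
the set. If the image is bounded, the linear map must kill them, so reducing their coefficients
modulo 1 yields a bounded mixed-integer set with the same image, and that set has only finitely many
integer patterns.

Lower bounds. By Minkowski–Weyl, itself derived from Fourier–Motzkin, a bounded polyhedron is the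
convex hull of finitely many points. Disjunctive programming then writes a bounded union as a linear
image of a `binarySet`: convex weights for each piece, and binary variables selecting the piece. The
generators enter only through the linear map, so the binary set has rational data even when `K` is
not rational, as the mixed-integer family demands. It remains to express `x i ∈ {0, 1}` within each
family. -/

/-- Affine functions with coefficients in the subfield `K`. -/
def IsAff (K : Subfield ℝ) {ι : Type} [Fintype ι] (f : (ι → ℝ) → ℝ) : Prop :=
  ∃ (a : ι → ℝ) (β : ℝ), (∀ i, a i ∈ K) ∧ β ∈ K ∧ ∀ x, f x = a ⬝ᵥ x + β

/-! ### Closure properties of affine functions. -/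

section Affine
variable {K : Subfield ℝ} {ι : Type} [Fintype ι] {f g : (ι → ℝ) → ℝ}

theorem IsAff.const {c : ℝ} (hc : c ∈ K) : IsAff K (fun _ : ι → ℝ => c) :=
  ⟨0, c, fun _ => K.zero_mem, hc, fun x => by simp⟩

theorem IsAff.coord (i : ι) : IsAff K (fun x : ι → ℝ => x i) := by
  classical
  refine ⟨Pi.single i 1, 0, fun j => ?_, K.zero_mem, fun x => by simp⟩
  by_cases h : j = i
  · subst h; simp [K.one_mem]
  · simp [h, K.zero_mem]

theorem IsAff.add (hf : IsAff K f) (hg : IsAff K g) : IsAff K (fun x => f x + g x) := by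
  obtain ⟨a, β, ha, hβ, h⟩ := hf
  obtain ⟨a', β', ha', hβ', h'⟩ := hg
  exact ⟨a + a', β + β', fun i => K.add_mem (ha i) (ha' i), K.add_mem hβ hβ',
    fun x => by simp only [h, h', add_dotProduct]; ring⟩

theorem IsAff.const_mul {c : ℝ} (hc : c ∈ K) (hf : IsAff K f) : IsAff K (fun x => c * f x) := by
  obtain ⟨a, β, ha, hβ, h⟩ := hf
  exact ⟨c • a, c * β, fun i => K.mul_mem hc (ha i), K.mul_mem hc hβ,
    fun x => by simp only [h, smul_dotProduct, smul_eq_mul]; ring⟩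

theorem IsAff.neg (hf : IsAff K f) : IsAff K (fun x => - f x) := by
  simpa using hf.const_mul (K.neg_mem K.one_mem)

theorem IsAff.sub (hf : IsAff K f) (hg : IsAff K g) : IsAff K (fun x => f x - g x) := by
  simpa [sub_eq_add_neg] using hf.add hg.neg

theorem IsAff.zero : IsAff K (fun _ : ι → ℝ => 0) := .const K.zero_mem

theorem IsAff.one : IsAff K (fun _ : ι → ℝ => 1) := .const K.one_mem

theorem IsAff.sum {κ : Type} {s : Finset κ} {F : κ → (ι → ℝ) → ℝ} (hF : ∀ k, IsAff K (F k)) :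
    IsAff K (fun x => ∑ k ∈ s, F k x) := by
  classical
  induction s using Finset.induction_on with
  | empty => simpa using IsAff.zero
  | insert k s hk ih => simpa [Finset.sum_insert hk] using (hF k).add ih

theorem IsAff.dotProduct {κ : Type} [Fintype κ] {a : κ → ℝ} (ha : ∀ k, a k ∈ K)
    {F : (ι → ℝ) → κ → ℝ} (hF : ∀ k, IsAff K (fun x => F x k)) :
    IsAff K (fun x => a ⬝ᵥ F x) :=
  IsAff.sum fun k => (hF k).const_mul (ha k)

theorem IsAff.linear {a : ι → ℝ} (ha : ∀ k, a k ∈ K) : IsAff K (fun x => a ⬝ᵥ x) :=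
  IsAff.dotProduct ha .coord

theorem IsAff.comp {κ : Type} [Fintype κ] (hf : IsAff K f)
    {F : (κ → ℝ) → ι → ℝ} (hF : ∀ k, IsAff K (fun x => F x k)) : IsAff K (fun x => f (F x)) := by
  obtain ⟨a, β, ha, hβ, h⟩ := hf
  simpa [h] using (IsAff.dotProduct ha hF).add (.const hβ)

end Affine

/-! ### Polyhedra and Fourier–Motzkin elimination. -/

/-- Polyhedra with data in the subfield `K`, for an arbitrary finite index type of coordinates. -/
def IsPoly (K : Subfield ℝ) {ι : Type} [Fintype ι] (S : Set (ι → ℝ)) : Prop :=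
  ∃ (m : ℕ) (a : Fin m → ι → ℝ) (β : Fin m → ℝ),
    (∀ k i, a k i ∈ K) ∧ (∀ k, β k ∈ K) ∧ S = {x | ∀ k, a k ⬝ᵥ x ≤ β k}

section Poly
variable {K : Subfield ℝ} {ι : Type} [Fintype ι]

theorem IsPoly.of_finite {κ : Type} [Finite κ] {a : κ → ι → ℝ} {β : κ → ℝ}
    (ha : ∀ k i, a k i ∈ K) (hβ : ∀ k, β k ∈ K) : IsPoly K {x | ∀ k, a k ⬝ᵥ x ≤ β k} := by
  obtain ⟨m, ⟨e⟩⟩ := Finite.exists_equiv_fin κ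
  refine ⟨m, fun k => a (e.symm k), fun k => β (e.symm k), fun k => ha _, fun k => hβ _, ?_⟩
  ext x
  exact e.forall_congr_left

theorem IsPoly.setOf_le {f g : (ι → ℝ) → ℝ} (hf : IsAff K f) (hg : IsAff K g) :
    IsPoly K {x | f x ≤ g x} := by
  obtain ⟨a, β, ha, hβ, h⟩ := hf.sub hg
  refine ⟨1, fun _ => a, fun _ => -β, fun _ => ha, fun _ => K.neg_mem hβ, ?_⟩
  ext x
  have := h x
  simp only [Set.mem_ofPred_eq, forall_const]
  constructor <;> intro <;> linarith

theorem IsPoly.iInter {κ : Type} [Finite κ] {S : κ → Set (ι → ℝ)} (hS : ∀ k, IsPoly K (S k)) :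
    IsPoly K {x | ∀ k, x ∈ S k} := by
  choose m a β ha hβ h using hS
  convert IsPoly.of_finite (K := K) (κ := Σ k, Fin (m k)) (a := fun p => a p.1 p.2)
    (β := fun p => β p.1 p.2) (fun p => ha _ _) (fun p => hβ _ _) using 1
  ext x
  have : ∀ k, x ∈ S k ↔ ∀ j, a k j ⬝ᵥ x ≤ β k j := fun k => by rw [h k]; rfl
  simp [this, Sigma.forall]

theorem IsPoly.univ : IsPoly K (Set.univ : Set (ι → ℝ)) := by
  simpa using IsPoly.iInter (K := K) (κ := Empty) (S := fun _ => (∅ : Set (ι → ℝ))) nofun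

theorem IsPoly.and {p q : (ι → ℝ) → Prop} (hp : IsPoly K {x | p x}) (hq : IsPoly K {x | q x}) :
    IsPoly K {x | p x ∧ q x} := by
  have := IsPoly.iInter (K := K) (κ := Bool)
    (S := fun b => if b then {x | p x} else {x | q x}) (by rintro (_ | _) <;> simpa)
  simpa [and_comm] using this

theorem IsPoly.setOf_eq {f g : (ι → ℝ) → ℝ} (hf : IsAff K f) (hg : IsAff K g) :
    IsPoly K {x | f x = g x} := by
  simpa [le_antisymm_iff] using (IsPoly.setOf_le hf hg).and (IsPoly.setOf_le hg hf)

theorem IsPoly.imp {q : Prop} {p : (ι → ℝ) → Prop} (hp : q → IsPoly K {x | p x}) :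
    IsPoly K {x | q → p x} := by
  by_cases h : q
  · simpa [h] using hp h
  · simpa [h] using IsPoly.univ

theorem IsPoly.forall {κ : Type} [Finite κ] {p : κ → (ι → ℝ) → Prop}
    (hp : ∀ k, IsPoly K {x | p k x}) : IsPoly K {x | ∀ k, p k x} :=
  IsPoly.iInter hp

theorem IsPoly.preimage {κ : Type} [Fintype κ] {S : Set (ι → ℝ)} (hS : IsPoly K S)
    {F : (κ → ℝ) → ι → ℝ} (hF : ∀ k, IsAff K (fun x => F x k)) : IsPoly K {x | F x ∈ S} := by
  obtain ⟨m, a, β, ha, hβ, rfl⟩ := hS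
  exact IsPoly.forall fun k => IsPoly.setOf_le (IsAff.dotProduct (ha k) hF) (.const (hβ k))

theorem IsPoly.mono {K' : Subfield ℝ} (h : K ≤ K') {S : Set (ι → ℝ)} (hS : IsPoly K S) :
    IsPoly K' S := by
  obtain ⟨m, a, β, ha, hβ, rfl⟩ := hS
  exact ⟨m, a, β, fun k i => h (ha k i), fun k => h (hβ k), rfl⟩

/-- The supremum of `L` works unless `L` is empty, when any lower bound of `U` does. This chooses
the eliminated variable in Fourier–Motzkin. -/
theorem exists_between_of_finite {L U : Set ℝ} (hL : L.Finite) (hU : U.Finite)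
    (h : ∀ l ∈ L, ∀ u ∈ U, l ≤ u) : ∃ t, (∀ l ∈ L, l ≤ t) ∧ ∀ u ∈ U, t ≤ u := by
  rcases L.eq_empty_or_nonempty with rfl | hne
  · obtain ⟨t, ht⟩ := hU.bddBelow
    exact ⟨t, by simp, fun u hu => ht hu⟩
  · exact ⟨sSup L, fun l hl => le_csSup hL.bddAbove hl,
      fun u hu => csSup_le hne fun l hl => h l hl u hu⟩

/-- Fourier–Motzkin elimination of one variable. -/
theorem IsPoly.exists_real {κ : Type} [Finite κ] {α : κ → ℝ} {f : κ → (ι → ℝ) → ℝ}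
    (hα : ∀ k, α k ∈ K) (hf : ∀ k, IsAff K (f k)) :
    IsPoly K {x | ∃ t, ∀ k, α k * t ≤ f k x} := by
  -- Constraints with `α k = 0` are kept. A negative `α k` bounds `t` from below and a positive `α
  -- l` from above, and each such pair must be compatible.
  have key : IsPoly K {x | (∀ k, α k = 0 → 0 ≤ f k x) ∧
      ∀ k, α k < 0 → ∀ l, 0 < α l → (α k)⁻¹ * f k x ≤ (α l)⁻¹ * f l x} :=
    (IsPoly.forall fun k => .imp fun _ => .setOf_le .zero (hf k)).and
      (.forall fun k => .imp fun _ => .forall fun l => .imp fun _ =>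
        .setOf_le ((hf k).const_mul (K.inv_mem (hα k))) ((hf l).const_mul (K.inv_mem (hα l))))
  convert key using 1
  ext x
  constructor
  · rintro ⟨t, ht⟩
    refine ⟨fun k hk => by simpa [hk] using ht k, fun k hk l hl => ?_⟩
    have h1 : (α k)⁻¹ * f k x ≤ t := by
      rw [inv_mul_eq_div, div_le_iff_of_neg hk, mul_comm]; exact ht k
    have h2 : t ≤ (α l)⁻¹ * f l x := by
      rw [inv_mul_eq_div, le_div_iff₀ hl, mul_comm]; exact ht l
    exact h1.trans h2
  · rintro ⟨h0, h1⟩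
    obtain ⟨t, hL, hU⟩ := exists_between_of_finite
      (L := (fun k => (α k)⁻¹ * f k x) '' {k | α k < 0})
      (U := (fun k => (α k)⁻¹ * f k x) '' {k | 0 < α k})
      ((Set.toFinite _).image _) ((Set.toFinite _).image _)
      (by rintro _ ⟨k, hk, rfl⟩ _ ⟨l, hl, rfl⟩; exact h1 k hk l hl)
    refine ⟨t, fun k => ?_⟩
    rcases lt_trichotomy (α k) 0 with hk | hk | hk
    · have : (α k)⁻¹ * f k x ≤ t := hL _ ⟨k, hk, rfl⟩
      rwa [inv_mul_eq_div, div_le_iff_of_neg hk, mul_comm] at this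
    · simpa [hk] using h0 k hk
    · have : t ≤ (α k)⁻¹ * f k x := hU _ ⟨k, hk, rfl⟩
      rwa [inv_mul_eq_div, le_div_iff₀ hk, mul_comm] at this

theorem IsPoly.exists_fin {m : ℕ} : ∀ {ι : Type} [Fintype ι] {S : Set (ι ⊕ Fin m → ℝ)},
    IsPoly K S → IsPoly K {x : ι → ℝ | ∃ y : Fin m → ℝ, Sum.elim x y ∈ S} := by
  induction m with
  | zero =>
    intro ι _ S hS
    have := hS.preimage (F := fun x : ι → ℝ => Sum.elim x (0 : Fin 0 → ℝ))
      (by rintro (i | i); exacts [.coord i, i.elim0])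
    convert this using 3 with x
    exact ⟨fun ⟨y, hy⟩ => by rwa [Subsingleton.elim (0 : Fin 0 → ℝ) y], fun h => ⟨0, h⟩⟩
  | succ m ih =>
    intro ι _ S hS
    obtain ⟨p, a, β, ha, hβ, rfl⟩ := hS
    -- Eliminate the coordinate `y 0`; the tail of `y` is left to the induction hypothesis.
    have h1 : IsPoly K {w : ι ⊕ Fin m → ℝ | ∃ t : ℝ, ∀ k, a k (.inr 0) * t ≤
        β k - ((fun i => a k (.inl i)) ⬝ᵥ (fun i => w (.inl i)) +
          (fun i => a k (.inr (Fin.succ i))) ⬝ᵥ (fun i => w (.inr i)))} :=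
      IsPoly.exists_real (fun k => ha _ _) fun k => (IsAff.const (hβ k)).sub
        ((IsAff.dotProduct (fun _ => ha _ _) fun i => .coord _).add
          (IsAff.dotProduct (fun _ => ha _ _) fun i => .coord _))
    convert ih h1 using 1
    ext x
    simp only [Set.mem_ofPred_eq, Sum.elim_inl, Sum.elim_inr]
    have key : ∀ (t : ℝ) (y : Fin m → ℝ) k, a k ⬝ᵥ Sum.elim x (Fin.cons t y) =
        (fun i => a k (.inl i)) ⬝ᵥ x + (a k (.inr 0) * t +
          (fun i => a k (.inr (Fin.succ i))) ⬝ᵥ y) := by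
      intro t y k
      simp [dotProduct, Fintype.sum_sum_type, Fin.sum_univ_succ]
    constructor
    · rintro ⟨y, hy⟩
      refine ⟨Fin.tail y, y 0, fun k => ?_⟩
      have := hy k
      rw [← Fin.cons_self_tail y, key] at this
      linarith
    · rintro ⟨y, t, hy⟩
      refine ⟨Fin.cons t y, fun k => ?_⟩
      rw [key]
      linarith [hy k]

theorem IsPoly.exists {κ : Type} [Fintype κ] {S : Set (ι ⊕ κ → ℝ)} (hS : IsPoly K S) :
    IsPoly K {x : ι → ℝ | ∃ y : κ → ℝ, Sum.elim x y ∈ S} := by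
  let e := Fintype.equivFin κ
  have h := (hS.preimage (F := fun w : ι ⊕ Fin (Fintype.card κ) → ℝ =>
    Sum.elim (fun i => w (.inl i)) (fun k => w (.inr (e k))))
    (by rintro (i | i) <;> exact .coord _)).exists_fin
  convert h using 3 with x
  constructor
  · rintro ⟨y, hy⟩
    exact ⟨y ∘ e.symm, by simpa using hy⟩
  · rintro ⟨y, hy⟩
    exact ⟨y ∘ e, hy⟩

/-- Images of polyhedra under affine maps are polyhedra. -/
theorem IsPoly.image {κ : Type} [Fintype κ] {S : Set (ι → ℝ)} (hS : IsPoly K S)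
    {F : (ι → ℝ) → κ → ℝ} (hF : ∀ k, IsAff K (fun x => F x k)) : IsPoly K (F '' S) := by
  have hc : ∀ i, IsAff K (fun w : κ ⊕ ι → ℝ => w (.inr i)) := fun i => .coord _
  have h := ((hS.preimage (F := fun (w : κ ⊕ ι → ℝ) i => w (.inr i)) hc).and
    (IsPoly.forall fun k => IsPoly.setOf_eq ((hF k).comp hc) (.coord (.inl k)))).exists
  convert h using 1
  ext y
  simp [Set.mem_image, funext_iff]

end Poly

/-! ### Finite unions of polyhedra. -/

/-- Finite unions of polyhedra with data in the subfield `K`. -/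
def IsPolyUnion (K : Subfield ℝ) {ι : Type} [Fintype ι] (S : Set (ι → ℝ)) : Prop :=
  ∃ (k : ℕ) (P : Fin k → Set (ι → ℝ)), (∀ i, IsPoly K (P i)) ∧ S = ⋃ i, P i

section PolyUnion
variable {K : Subfield ℝ} {ι : Type} [Fintype ι]

theorem IsPolyUnion.of_finite {κ : Type} [Finite κ] {P : κ → Set (ι → ℝ)}
    (hP : ∀ k, IsPoly K (P k)) : IsPolyUnion K (⋃ k, P k) := by
  obtain ⟨m, ⟨e⟩⟩ := Finite.exists_equiv_fin κ
  exact ⟨m, fun k => P (e.symm k), fun k => hP _, (e.symm.surjective.iUnion_comp P).symm⟩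

theorem IsPolyUnion.exists {κ : Type} [Finite κ] {q : κ → Prop} {p : κ → (ι → ℝ) → Prop}
    (hp : ∀ k, IsPoly K {x | p k x}) : IsPolyUnion K {x | ∃ k, q k ∧ p k x} := by
  convert IsPolyUnion.of_finite (K := K) (κ := {k // q k}) (fun k => hp k.1) using 1
  ext x
  simp

theorem IsPolyUnion.image {κ : Type} [Fintype κ] {S : Set (ι → ℝ)} (hS : IsPolyUnion K S)
    {F : (ι → ℝ) → κ → ℝ} (hF : ∀ k, IsAff K (fun x => F x k)) : IsPolyUnion K (F '' S) := by
  obtain ⟨k, P, hP, rfl⟩ := hS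
  exact ⟨k, fun i => F '' P i, fun i => (hP i).image hF, Set.image_iUnion⟩

end PolyUnion

/-! ### Minkowski–Weyl theory for cones and polyhedra. -/

section Cones
variable {K : Subfield ℝ} {ι : Type} [Fintype ι]

theorem dotProduct_sum_smul {κ : Type} [Fintype κ] (a : ι → ℝ) (c : κ → ℝ) (v : κ → ι → ℝ) :
    a ⬝ᵥ (∑ j, c j • v j) = ∑ j, c j * (a ⬝ᵥ v j) := by
  simp [dotProduct_sum]

theorem nonpos_of_forall_mul_le {u β : ℝ} (h : ∀ s : ℝ, 0 ≤ s → s * u ≤ β) : u ≤ 0 := by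
  by_contra! hu
  have h1 := h ((|β| + 1) / u) (by positivity)
  rw [div_mul_cancel₀ _ hu.ne'] at h1
  linarith [le_abs_self β]

/-- Finitely generated cones are polyhedral. -/
theorem exists_halfspaces_of_generators {κ : Type} [Fintype κ] {v : κ → ι → ℝ}
    (hv : ∀ j i, v j i ∈ K) :
    ∃ (p : ℕ) (w : Fin p → ι → ℝ), (∀ k i, w k i ∈ K) ∧ ∀ x,
      (∀ k, w k ⬝ᵥ x ≤ 0) ↔ ∃ c : κ → ℝ, (∀ j, 0 ≤ c j) ∧ x = ∑ j, c j • v j := by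
  -- The cone is the linear image of the nonnegative orthant of coefficients, hence a polyhedron.
  have h0 : IsPoly K {c : κ → ℝ | ∀ j, 0 ≤ c j} :=
    IsPoly.forall fun j => IsPoly.setOf_le .zero (.coord j)
  have h1 := h0.image (F := fun c => ∑ j, c j • v j) fun i => by
    simp only [Finset.sum_apply, Pi.smul_apply, smul_eq_mul]
    exact IsAff.sum fun j => by simpa [mul_comm] using (IsAff.coord j).const_mul (hv j i)
  obtain ⟨p, w, β, hw, -, h⟩ := h1
  have hmem : ∀ x, (∃ c : κ → ℝ, (∀ j, 0 ≤ c j) ∧ x = ∑ j, c j • v j) ↔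
      ∀ k, w k ⬝ᵥ x ≤ β k := fun x => by
    have : x ∈ (fun c : κ → ℝ => ∑ j, c j • v j) '' {c : κ → ℝ | ∀ j, 0 ≤ c j} ↔ _ :=
      Set.ext_iff.1 h x
    refine Iff.trans ?_ this
    simp only [Set.mem_image, Set.mem_ofPred_eq, eq_comm]
  refine ⟨p, w, hw, fun x => ?_⟩
  rw [hmem]
  -- The right-hand sides can be replaced by zero: they are nonnegative because the cone contains
  -- `0`, and invariance under scaling forces `w k ⬝ᵥ x ≤ 0` on it.
  have hβ : ∀ k, 0 ≤ β k := by
    simpa using (hmem 0).1 ⟨0, by simp, by simp⟩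
  refine ⟨fun hx k => (hx k).trans (hβ k), fun hx k => nonpos_of_forall_mul_le (β := β k) fun s hs => ?_⟩
  obtain ⟨c, hc, rfl⟩ := (hmem x).2 hx
  have := (hmem (s • ∑ j, c j • v j)).1
    ⟨s • c, fun j => mul_nonneg hs (hc j), by simp [Finset.smul_sum, smul_smul]⟩ k
  simpa using this

/-- Polyhedral cones are finitely generated. -/
theorem exists_generators_of_halfspaces {κ : Type} [Fintype κ] {a : κ → ι → ℝ}
    (ha : ∀ k i, a k i ∈ K) :
    ∃ (m : ℕ) (v : Fin m → ι → ℝ), (∀ j i, v j i ∈ K) ∧ ∀ x,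
      (∀ k, a k ⬝ᵥ x ≤ 0) ↔ ∃ c : Fin m → ℝ, (∀ j, 0 ≤ c j) ∧ x = ∑ j, c j • v j := by
  classical
  -- Double polarity. The `v j` cut out the cone generated by the `a k`, and the `w k` cut out the
  -- cone generated by the `v j`. Then `v j ⬝ᵥ w k ≤ 0` places `w k` in the cone of the `a k`, so `a
  -- k ⬝ᵥ x ≤ 0` for all `k` implies `w k ⬝ᵥ x ≤ 0`.
  obtain ⟨m, v, hv, hav⟩ := exists_halfspaces_of_generators ha
  obtain ⟨p, w, hw, hvw⟩ := exists_halfspaces_of_generators hv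
  refine ⟨m, v, hv, fun x => ⟨fun hx => (hvw x).1 fun k => ?_, ?_⟩⟩
  · have h1 : ∀ j, v j ⬝ᵥ w k ≤ 0 := fun j => by
      rw [dotProduct_comm]
      exact (hvw (v j)).2 ⟨Pi.single j 1, fun i => by by_cases h : i = j <;> simp [h],
        by simp [Pi.single_apply]⟩ k
    obtain ⟨c, hc, hk⟩ := (hav (w k)).1 h1
    rw [hk, dotProduct_comm, dotProduct_sum_smul]
    exact Finset.sum_nonpos fun j _ =>
      mul_nonpos_of_nonneg_of_nonpos (hc j) (by rw [dotProduct_comm]; exact hx j)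
  · rintro ⟨c, hc, rfl⟩ k
    have h1 := (hav (a k)).2 ⟨Pi.single k 1,
      fun i => by by_cases h : i = k <;> simp [h], by simp [Pi.single_apply]⟩
    rw [dotProduct_sum_smul]
    exact Finset.sum_nonpos fun j _ =>
      mul_nonpos_of_nonneg_of_nonpos (hc j) (by rw [dotProduct_comm]; exact h1 j)

/-- The Minkowski–Weyl decomposition of a polyhedron. The generators `v j` with `t j = 1` are points
and those with `t j = 0` are directions. -/
theorem exists_generators_of_poly {κ : Type} [Fintype κ] {a : κ → ι → ℝ} {β : κ → ℝ}
    (ha : ∀ k i, a k i ∈ K) (hβ : ∀ k, β k ∈ K) :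
    ∃ (m : ℕ) (v : Fin m → ι → ℝ) (t : Fin m → ℝ), (∀ j i, v j i ∈ K) ∧
      (∀ j, t j = 0 ∨ t j = 1) ∧ (∀ j k, a k ⬝ᵥ v j ≤ t j * β k) ∧ ∀ x,
      (∀ k, a k ⬝ᵥ x ≤ β k) ↔
        ∃ c : Fin m → ℝ, (∀ j, 0 ≤ c j) ∧ ∑ j, c j * t j = 1 ∧ x = ∑ j, c j • v j := by
  classical
  -- Homogenize: the coordinate `none` is a scale `t` with `-t ≤ 0`, and the constraints become `a k
  -- ⬝ᵥ x - β k * t ≤ 0`. The polyhedron is the slice `t = 1`.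
  obtain ⟨m, v, hv, h⟩ := exists_generators_of_halfspaces (K := K) (κ := Option κ)
    (a := fun o => (Option.elim (α := κ) o (fun i : Option ι => Option.elim i (-1) fun _ => 0)
      fun k (i : Option ι) => Option.elim i (-β k) (a k)))
    (by
      rintro (_ | k) (_ | i)
      exacts [K.neg_mem K.one_mem, K.zero_mem, K.neg_mem (hβ k), ha k i])
  have hcone : ∀ y : Option ι → ℝ, (0 ≤ y none ∧ ∀ k, a k ⬝ᵥ (fun i => y (some i)) ≤ y none * β k)
      ↔ ∃ c : Fin m → ℝ, (∀ j, 0 ≤ c j) ∧ y = ∑ j, c j • v j := by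
    intro y
    rw [← h, Option.forall]
    simp only [dotProduct, Fintype.sum_option, Option.elim]
    refine and_congr (by simp) (forall_congr' fun k => ?_)
    constructor <;> intro h <;> linarith
  have hgen : ∀ j, 0 ≤ v j none ∧ ∀ k, a k ⬝ᵥ (fun i => v j (some i)) ≤ v j none * β k :=
    fun j => (hcone (v j)).2 ⟨Pi.single j 1,
      fun i => by by_cases h : i = j <;> simp [h], by simp [Pi.single_apply]⟩
  -- Dividing by `s j` gives the generators of positive scale the scale 1 and leaves the directions
  -- unchanged.
  set s : Fin m → ℝ := fun j => if v j none = 0 then 1 else v j none with hs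
  have hspos : ∀ j, 0 < s j := fun j => by
    by_cases h0 : v j none = 0
    · simp [hs, h0]
    · simpa [hs, h0] using lt_of_le_of_ne (hgen j).1 (Ne.symm h0)
  refine ⟨m, fun j i => (s j)⁻¹ * v j (some i), fun j => (s j)⁻¹ * v j none, fun j i => ?_,
    fun j => ?_, fun j k => ?_, fun x => ?_⟩
  · refine K.mul_mem (K.inv_mem ?_) (hv _ _)
    by_cases h0 : v j none = 0
    · simp [hs, h0]
    · simpa [hs, h0] using hv j none
  · by_cases h0 : v j none = 0 <;> simp [hs, h0]
  · have h1 : a k ⬝ᵥ (fun i => (s j)⁻¹ * v j (some i)) =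
        (s j)⁻¹ * (a k ⬝ᵥ fun i => v j (some i)) := by
      simp only [dotProduct, Finset.mul_sum]
      exact Finset.sum_congr rfl fun _ _ => by ring
    rw [h1, mul_assoc]
    exact mul_le_mul_of_nonneg_left ((hgen j).2 k) (inv_nonneg.2 (hspos j).le)
  · have h1 := hcone fun o => Option.elim o 1 x
    simp only [Option.elim, zero_le_one, true_and, one_mul] at h1
    rw [h1]
    constructor
    · rintro ⟨c, hc, hx⟩
      refine ⟨fun j => c j * s j, fun j => mul_nonneg (hc j) (hspos j).le, ?_, ?_⟩
      · have := congrFun hx none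
        simp only [Finset.sum_apply, Pi.smul_apply, smul_eq_mul] at this
        rw [this]
        exact Finset.sum_congr rfl fun j _ => by field_simp [(hspos j).ne']
      · ext i
        have := congrFun hx (some i)
        simp only [Finset.sum_apply, Pi.smul_apply, smul_eq_mul] at this ⊢
        rw [this]
        exact Finset.sum_congr rfl fun j _ => by field_simp [(hspos j).ne']
    · rintro ⟨c, hc, h1, hx⟩
      refine ⟨fun j => c j * (s j)⁻¹, fun j => mul_nonneg (hc j) (inv_nonneg.2 (hspos j).le), ?_⟩
      ext o
      rcases o with _ | i
      · simpa [mul_assoc] using h1.symm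
      · simp [hx, mul_assoc]

theorem eq_zero_of_forall_abs_mul_le {u C : ℝ} (h : ∀ n : ℕ, |n * u| ≤ C) : u = 0 := by
  by_contra hu
  obtain ⟨n, hn⟩ := exists_nat_gt (C / |u|)
  rw [div_lt_iff₀ (abs_pos.2 hu)] at hn
  have := h n
  rw [abs_mul, Nat.abs_cast] at this
  linarith

/-- Integer steps suffice, so this also applies to images of mixed-integer sets. -/
theorem eq_zero_of_bounded_ray {S : Set (ι → ℝ)} (hS : Bornology.IsBounded S) {x v : ι → ℝ}
    (h : ∀ n : ℕ, x + (n : ℝ) • v ∈ S) : v = 0 := by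
  obtain ⟨C, hC⟩ := hS.exists_norm_le
  ext i
  refine eq_zero_of_forall_abs_mul_le (C := C + ‖x‖) fun n => ?_
  have h1 := (norm_le_pi_norm _ i).trans (hC _ (h n))
  have h2 := norm_le_pi_norm x i
  simp only [Pi.add_apply, Pi.smul_apply, smul_eq_mul, Real.norm_eq_abs] at h1 h2
  have h3 : |(n : ℝ) * v i| ≤ |x i + n * v i| + |x i| := by
    simpa using abs_sub (x i + n * v i) (x i)
  linarith

/-- Bounded polyhedra are convex hulls of finitely many points. The generators that are not points,
those with `t j = 0`, are all zero. -/
theorem exists_generators_of_bounded {S : Set (ι → ℝ)} (hS : IsPoly K S)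
    (hb : Bornology.IsBounded S) :
    ∃ (m : ℕ) (v : Fin m → ι → ℝ) (t : Fin m → ℝ), (∀ j i, v j i ∈ K) ∧
      (∀ j, t j = 0 ∧ v j = 0 ∨ t j = 1) ∧ ∀ x, x ∈ S ↔
        ∃ c : Fin m → ℝ, (∀ j, 0 ≤ c j) ∧ ∑ j, c j * t j = 1 ∧ x = ∑ j, c j • v j := by
  rcases S.eq_empty_or_nonempty with rfl | ⟨x, hx⟩
  · exact ⟨0, nofun, nofun, nofun, nofun, fun x => by simp⟩
  · obtain ⟨p, a, β, ha, hβ, rfl⟩ := hS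
    obtain ⟨m, v, t, hv, ht, hav, h⟩ := exists_generators_of_poly ha hβ
    refine ⟨m, v, t, hv, fun j => (ht j).imp_left fun h0 => ⟨h0, ?_⟩, h⟩
    refine eq_zero_of_bounded_ray hb (x := x) fun n k => ?_
    have h1 := hav j k
    rw [h0, zero_mul] at h1
    rw [dotProduct_add, dotProduct_smul, smul_eq_mul]
    have h2 := mul_nonpos_of_nonneg_of_nonpos (Nat.cast_nonneg (α := ℝ) n) h1
    have h3 : a k ⬝ᵥ x ≤ β k := hx k
    linarith

end Cones

/-! ### CBL-, LC- and PRC-representable sets are finite unions of polyhedra. -/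

section Upper
variable {K : Subfield ℝ}

theorem IsAff.mulVec {ι : Type} [Fintype ι] {m n : ℕ} {L : Matrix (Fin m) (Fin n) ℝ}
    (hL : ∀ i j, L i j ∈ K) {F : (ι → ℝ) → Fin n → ℝ} (hF : ∀ k, IsAff K (fun x => F x k))
    (i : Fin m) : IsAff K (fun x => (L *ᵥ F x) i) :=
  IsAff.dotProduct (hL i) hF

theorem isPolyUnion_of_mem_representable {T : SetFamily} (hT : ∀ n, ∀ S ∈ T n, IsPolyUnion K S)
    {n : ℕ} {S : Set (Fin n → ℝ)} (hS : S ∈ T.representable K n) : IsPolyUnion K S := by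
  obtain ⟨m, T₀, L, h₀, hL, rfl⟩ := hS
  exact (hT m T₀ h₀).image (IsAff.mulVec hL .coord)

/-- A sufficiently small step preserves the slack constraints, and the tight ones do not increase at
all. -/
theorem exists_pos_step {κ : Type} [Finite κ] {u w r : κ → ℝ} (h : ∀ k, u k ≤ r k)
    (h' : ∀ k, u k = r k → w k ≤ 0) : ∃ ε : ℝ, 0 < ε ∧ ∀ k, u k + ε * w k ≤ r k := by
  have h1 : ∀ᶠ ε in nhdsWithin (0 : ℝ) (Set.Ioi 0), ∀ k, u k + ε * w k ≤ r k := by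
    rw [Filter.eventually_all]
    intro k
    rcases (h k).eq_or_lt with hk | hk
    · filter_upwards [self_mem_nhdsWithin] with ε hε
      have := mul_nonpos_of_nonneg_of_nonpos (le_of_lt hε) (h' k hk)
      linarith
    · have hc : Continuous fun ε : ℝ => u k + ε * w k := by fun_prop
      have h2 : ∀ᶠ ε in nhds (0 : ℝ), u k + ε * w k < r k :=
        hc.continuousAt.eventually_lt continuousAt_const (by simpa using hk)
      exact (h2.filter_mono nhdsWithin_le_nhds).mono fun _ => le_of_lt
  obtain ⟨ε, h2, h3⟩ := (h1.and self_mem_nhdsWithin).exists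
  exact ⟨ε, h3, h2⟩

/-- A feasible point of a linear program is optimal iff some set of active constraints admits no
improving direction. -/
theorem isLowerOptimal_iff {nl nf mf : ℕ} (f : Fin nf → ℝ) (C : Matrix (Fin mf) (Fin nl) ℝ)
    (D : Matrix (Fin mf) (Fin nf) ℝ) (g : Fin mf → ℝ) (x : Fin nl → ℝ) (y : Fin nf → ℝ) :
    IsLowerOptimal f C D g ∅ x y ↔ ∃ J : Set (Fin mf),
      (∀ d, (∀ i ∈ J, (D *ᵥ d) i ≤ 0) → f ⬝ᵥ d ≤ 0) ∧
      ((∀ i, (D *ᵥ y) i ≤ g i - (C *ᵥ x) i) ∧ ∀ i, i ∈ J → (D *ᵥ y) i = g i - (C *ᵥ x) i) := by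
  simp only [IsLowerOptimal, Set.mem_empty_iff_false, false_imp_iff, implies_true, and_true,
    forall_const, Pi.le_def, Pi.sub_apply]
  constructor
  · rintro ⟨hy, hopt⟩
    refine ⟨{i | (D *ᵥ y) i = g i - (C *ᵥ x) i}, fun d hd => ?_, hy, fun i hi => hi⟩
    obtain ⟨ε, hε, h⟩ := exists_pos_step hy hd
    have := hopt (y + ε • d) fun i => by simpa [Matrix.mulVec_add, Matrix.mulVec_smul] using h i
    rw [dotProduct_add, dotProduct_smul, smul_eq_mul] at this
    exact nonpos_of_mul_nonpos_right (by linarith) hε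
  · rintro ⟨J, hJ, hy, hact⟩
    refine ⟨hy, fun y' hy' => ?_⟩
    have := hJ (y' - y) fun i hi => by
      rw [Matrix.mulVec_sub, Pi.sub_apply, hact i hi]
      linarith [hy' i]
    rw [dotProduct_sub] at this
    linarith

/-- In `isLowerOptimal_iff` the condition on improving directions involves `J` but not the point, so
it merely selects which `J` contribute; each contributes one polyhedron. -/
theorem isPolyUnion_of_mem_cblSets {n : ℕ} {S : Set (Fin n → ℝ)} (hS : S ∈ cblSets K n) :
    IsPolyUnion K S := by
  obtain ⟨nl, nf, ml, mf, rfl, A, B, b, f, C, D, g, hA, hB, hb, hf, hC, hD, hg, rfl⟩ := hS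
  have hx : ∀ i, IsAff K (fun z : Fin (nl + nf) → ℝ => z (Fin.cast rfl (Fin.castAdd nf i))) :=
    fun i => .coord _
  have hy : ∀ i, IsAff K (fun z : Fin (nl + nf) → ℝ => z (Fin.cast rfl (Fin.natAdd nl i))) :=
    fun i => .coord _
  have hr : ∀ i, IsAff K (fun z : Fin (nl + nf) → ℝ => g i -
      (C *ᵥ fun i => z (Fin.cast rfl (Fin.castAdd nf i))) i) :=
    fun i => (IsAff.const (hg i)).sub (.mulVec hC hx i)
  convert IsPolyUnion.exists (K := K) (κ := Set (Fin mf))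
    (q := fun J => ∀ d, (∀ i ∈ J, (D *ᵥ d) i ≤ 0) → f ⬝ᵥ d ≤ 0)
    (fun J => (IsPoly.forall fun i => IsPoly.setOf_le
      ((IsAff.mulVec hA hx i).add (.mulVec hB hy i)) (.const (hb i))).and
      ((IsPoly.forall fun i => IsPoly.setOf_le (.mulVec hD hy i) (hr i)).and
      (.forall fun i => .imp (q := i ∈ J) fun _ => .setOf_eq (.mulVec hD hy i) (hr i)))) using 1
  ext z
  simp only [Set.mem_ofPred_eq, InBilevelSet, isLowerOptimal_iff, Set.mem_empty_iff_false,
    false_imp_iff, implies_true, and_true, Pi.le_def, Pi.add_apply]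
  constructor
  · rintro ⟨h, J, hJ, h'⟩
    exact ⟨J, hJ, h, h'⟩
  · rintro ⟨J, hJ, h, h'⟩
    exact ⟨h, J, hJ, h'⟩

theorem isPolyUnion_of_mem_lcSets {n : ℕ} {S : Set (Fin n → ℝ)} (hS : S ∈ lcSets K n) :
    IsPolyUnion K S := by
  obtain ⟨m, M, q, A, b, hM, hq, hA, hb, rfl⟩ := hS
  have hc : ∀ i, IsAff K (fun x : Fin n → ℝ => (M *ᵥ x) i + q i) :=
    fun i => (IsAff.mulVec hM .coord i).add (.const (hq i))
  convert IsPolyUnion.exists (K := K) (κ := Set (Fin n)) (q := fun _ => True)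
    (fun J => (IsPoly.forall fun i => IsPoly.setOf_le .zero (.coord i)).and
      ((IsPoly.forall fun i => IsPoly.setOf_le .zero (hc i)).and
      ((IsPoly.forall fun i => IsPoly.setOf_le (.mulVec hA .coord i) (.const (hb i))).and
      ((IsPoly.forall fun i => .imp (q := i ∈ J) fun _ => .setOf_eq (.coord i) .zero).and
      (.forall fun i => .imp (q := i ∉ J) fun _ => .setOf_eq (hc i) .zero))))) using 1
  ext x
  simp only [Set.mem_ofPred_eq, Pi.le_def, Pi.zero_apply, Pi.add_apply, true_and, dotProduct]
  constructor
  · rintro ⟨h1, h2, h3, h4⟩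
    rw [Finset.sum_eq_zero_iff_of_nonneg fun i _ => mul_nonneg (h1 i) (h2 i)] at h3
    exact ⟨{i | x i = 0}, h1, h2, h4, fun i hi => hi,
      fun i hi => (mul_eq_zero.1 (h3 i (Finset.mem_univ i))).resolve_left hi⟩
  · rintro ⟨J, h1, h2, h4, h5, h6⟩
    refine ⟨h1, h2, Finset.sum_eq_zero fun i _ => ?_, h4⟩
    by_cases hi : i ∈ J
    · rw [h5 i hi, zero_mul]
    · rw [h6 i hi, mul_zero]

theorem isPolyUnion_of_mem_prcSets {n : ℕ} {S : Set (Fin n → ℝ)} (hS : S ∈ prcSets K n) :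
    IsPolyUnion K S := by
  obtain ⟨n', m, A, b, f, hA, hb, hf, rfl⟩ := hS
  choose k α β hα hβ h using hf
  convert IsPolyUnion.exists (K := K) (κ := ∀ i, Fin (k i)) (q := fun _ => True)
    (fun J => (IsPoly.forall fun i => IsPoly.setOf_le (.mulVec hA .coord i) (.const (hb i))).and
      (.forall fun i => IsPoly.setOf_le .zero
        ((IsAff.linear (hα i (J i))).sub (.const (hβ i (J i)))))) using 1
  ext x
  simp only [Set.mem_ofPred_eq, Pi.le_def, true_and]
  constructor
  · rintro ⟨h1, h2⟩
    choose J hJ using fun i => (h i x).1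
    exact ⟨J, h1, fun i => (h2 i).trans_eq (hJ i).symm⟩
  · rintro ⟨J, h1, h2⟩
    exact ⟨h1, fun i => (h2 i).trans ((h i x).2 ⟨J i, rfl⟩)⟩

end Upper

/-! ### Bounded MILP-representable sets are finite unions of polyhedra. -/

section MixedInteger

theorem IsInt.add {s t : ℝ} (hs : IsInt s) (ht : IsInt t) : IsInt (s + t) := by
  obtain ⟨y, rfl⟩ := hs
  obtain ⟨z, rfl⟩ := ht
  exact ⟨y + z, by simp⟩

theorem IsInt.mul {s t : ℝ} (hs : IsInt s) (ht : IsInt t) : IsInt (s * t) := by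
  obtain ⟨y, rfl⟩ := hs
  obtain ⟨z, rfl⟩ := ht
  exact ⟨y * z, by simp⟩

theorem IsInt.natCast (n : ℕ) : IsInt (n : ℝ) := ⟨n, by simp⟩

theorem IsInt.sum {κ : Type} {s : Finset κ} {f : κ → ℝ} (h : ∀ k, IsInt (f k)) :
    IsInt (∑ k ∈ s, f k) := by
  choose z hz using h
  exact ⟨∑ k ∈ s, z k, by simp [hz]⟩

theorem mem_bot_iff {t : ℝ} : t ∈ (⊥ : Subfield ℝ) ↔ t ∈ rationals := by
  rw [Subfield.bot_eq_of_charZero]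
  rfl

theorem exists_nat_mul_isInt {ι : Type} [Fintype ι] {r : ι → ℝ} (hr : ∀ i, r i ∈ rationals) :
    ∃ N : ℕ, 0 < N ∧ ∀ i, IsInt (N * r i) := by
  classical
  choose q hq using hr
  refine ⟨∏ i, (q i).den, Finset.prod_pos fun i _ => (q i).pos, fun i => ?_⟩
  rw [← Finset.prod_erase_mul _ _ (Finset.mem_univ i), ← hq i, Nat.cast_mul, mul_assoc]
  refine (IsInt.natCast _).mul ⟨(q i).num, ?_⟩
  exact_mod_cast (q i).den_mul_eq_num

/-- A rational polyhedral cone is generated by integral vectors. -/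
theorem exists_integral_generators {ι κ : Type} [Fintype ι] [Fintype κ] {a : κ → ι → ℝ}
    (ha : ∀ k i, a k i ∈ rationals) :
    ∃ (m : ℕ) (v : Fin m → ι → ℝ), (∀ j i, IsInt (v j i)) ∧ ∀ x,
      (∀ k, a k ⬝ᵥ x ≤ 0) ↔ ∃ c : Fin m → ℝ, (∀ j, 0 ≤ c j) ∧ x = ∑ j, c j • v j := by
  obtain ⟨m, v, hv, h⟩ := exists_generators_of_halfspaces (K := ⊥)
    fun k i => mem_bot_iff.2 (ha k i)
  choose N hN hNv using fun j => exists_nat_mul_isInt fun i => mem_bot_iff.1 (hv j i)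
  refine ⟨m, fun j => (N j : ℝ) • v j, hNv, fun x => (h x).trans ?_⟩
  have hN' : ∀ j, (0 : ℝ) < N j := fun j => Nat.cast_pos.2 (hN j)
  constructor
  · rintro ⟨c, hc, rfl⟩
    refine ⟨fun j => c j / N j, fun j => div_nonneg (hc j) (hN' j).le,
      Finset.sum_congr rfl fun j _ => ?_⟩
    rw [smul_smul, div_mul_cancel₀ _ (hN' j).ne']
  · rintro ⟨c, hc, rfl⟩
    exact ⟨fun j => c j * N j, fun j => mul_nonneg (hc j) (hN' j).le, by simp [smul_smul]⟩

variable {K : Subfield ℝ} {ι : Type} [Fintype ι]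

/-- A polyhedron is the sum of a bounded subset and a recession cone. -/
theorem exists_bounded_part {κ : Type} [Fintype κ] {a : κ → ι → ℝ} {β : κ → ℝ} :
    ∃ C : ℝ, ∀ x, (∀ k, a k ⬝ᵥ x ≤ β k) → ∃ y, (∀ k, a k ⬝ᵥ y ≤ β k) ∧ (∀ i, |y i| ≤ C) ∧
      ∀ k, a k ⬝ᵥ (x - y) ≤ 0 := by
  obtain ⟨m, v, t, -, ht, hav, h⟩ := exists_generators_of_poly (K := ⊤) (a := a) (β := β)
    (fun _ _ => Subfield.mem_top _) (fun _ => Subfield.mem_top _)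
  refine ⟨∑ i, ∑ j, |v j i|, fun x hx => ?_⟩
  obtain ⟨c, hc, h1, rfl⟩ := (h x).1 hx
  have ht0 : ∀ j, 0 ≤ t j := fun j => by rcases ht j with h | h <;> simp [h]
  have htt : ∀ j, t j * t j = t j := fun j => by rcases ht j with h | h <;> simp [h]
  -- Keep the generators that are points and drop the directions; the remaining coefficients are at
  -- most 1, which bounds the coordinates.
  refine ⟨∑ j, (c j * t j) • v j, fun k => ?_, fun i => ?_, fun k => ?_⟩
  · rw [dotProduct_sum_smul]
    calc ∑ j, c j * t j * (a k ⬝ᵥ v j) ≤ ∑ j, c j * t j * (t j * β k) :=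
          Finset.sum_le_sum fun j _ =>
            mul_le_mul_of_nonneg_left (hav j k) (mul_nonneg (hc j) (ht0 j))
      _ = (∑ j, c j * t j) * β k := by
          rw [Finset.sum_mul]
          exact Finset.sum_congr rfl fun j _ => by
            rw [← mul_assoc, mul_assoc (c j), htt]
      _ = β k := by rw [h1, one_mul]
  · have h2 : ∀ j, c j * t j ≤ 1 := fun j => by
      rw [← h1]
      exact Finset.single_le_sum (f := fun j => c j * t j)
        (fun j _ => mul_nonneg (hc j) (ht0 j)) (Finset.mem_univ j)
    simp only [Finset.sum_apply, Pi.smul_apply, smul_eq_mul]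
    calc |∑ j, c j * t j * v j i| ≤ ∑ j, |c j * t j * v j i| := Finset.abs_sum_le_sum_abs _ _
      _ ≤ ∑ j, |v j i| := Finset.sum_le_sum fun j _ => by
          rw [abs_mul, abs_of_nonneg (mul_nonneg (hc j) (ht0 j))]
          exact mul_le_of_le_one_left (abs_nonneg _) (h2 j)
      _ ≤ _ := Finset.single_le_sum (f := fun i => ∑ j, |v j i|)
          (fun i _ => Finset.sum_nonneg fun j _ => abs_nonneg _) (Finset.mem_univ i)
  · rw [dotProduct_sub, dotProduct_sum_smul, dotProduct_sum_smul, ← Finset.sum_sub_distrib]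
    refine Finset.sum_nonpos fun j _ => ?_
    rcases ht j with h0 | h0
    · have := hav j k
      rw [h0, zero_mul] at this
      simpa [h0] using mul_nonpos_of_nonneg_of_nonpos (hc j) this
    · simp [h0]

/-- A mixed-integer set with rational constraint matrix is the sum of a bounded subset and a monoid
of integral recession directions; if its image under an additive map is bounded, then the bounded
subset has the same image. -/
theorem exists_bounded_subset_image_eq {κ κ' : Type} [Fintype κ] [Fintype κ'] {a : κ → ι → ℝ}
    {β : κ → ℝ} (ha : ∀ k i, a k i ∈ rationals) (I : Set ι) (L : (ι → ℝ) →ₗ[ℝ] (κ' → ℝ))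
    (hb : Bornology.IsBounded (L '' {x | (∀ k, a k ⬝ᵥ x ≤ β k) ∧ ∀ i ∈ I, IsInt (x i)})) :
    ∃ N : ℤ, L '' {x | (∀ k, a k ⬝ᵥ x ≤ β k) ∧ ∀ i ∈ I, IsInt (x i)} =
      L '' {x | ((∀ k, a k ⬝ᵥ x ≤ β k) ∧ ∀ i ∈ I, IsInt (x i)) ∧
        ∀ i, -(N : ℝ) ≤ x i ∧ x i ≤ N} := by
  obtain ⟨p, r, hr, hcone⟩ := exists_integral_generators ha
  obtain ⟨C, hC⟩ := exists_bounded_part (a := a) (β := β)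
  have hra : ∀ j k, a k ⬝ᵥ r j ≤ 0 := by
    classical
    exact fun j => (hcone (r j)).2 ⟨Pi.single j 1,
      fun i => by by_cases h : i = j <;> simp [h], by simp [Pi.single_apply]⟩
  refine ⟨⌈C + ∑ i, ∑ j, |r j i|⌉, Set.Subset.antisymm ?_ (Set.image_mono fun x hx => hx.1)⟩
  rintro _ ⟨x, ⟨hx, hxI⟩, rfl⟩
  -- Integrality of `r j` keeps the points `x + n • r j` in the mixed-integer set, so their images
  -- form a bounded ray.
  have hLr : ∀ j, L (r j) = 0 := fun j => by
    refine eq_zero_of_bounded_ray hb (x := L x) fun n =>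
      ⟨x + (n : ℝ) • r j, ⟨fun k => ?_, fun i hi => ?_⟩, by simp⟩
    · rw [dotProduct_add, dotProduct_smul, smul_eq_mul]
      linarith [hx k, mul_nonpos_of_nonneg_of_nonpos (Nat.cast_nonneg (α := ℝ) n) (hra j k)]
    · exact (hxI i hi).add ((IsInt.natCast n).mul (hr j i))
  obtain ⟨y, hy, hyC, hxy⟩ := hC x hx
  obtain ⟨c, hc, hcxy⟩ := (hcone (x - y)).1 hxy
  -- The left side shows that the new point is bounded; the right side shows that it differs from
  -- `x` by integral vectors in the kernel of `L`.
  have hx' : y + ∑ j, Int.fract (c j) • r j = x + ∑ j, (-(⌊c j⌋ : ℝ)) • r j := by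
    rw [eq_add_of_sub_eq hcxy, add_comm _ y, add_assoc, ← Finset.sum_add_distrib]
    simp only [← add_smul, Int.fract, sub_eq_add_neg]
  refine ⟨y + ∑ j, Int.fract (c j) • r j, ⟨⟨fun k => ?_, fun i hi => ?_⟩, fun i => ?_⟩, ?_⟩
  · rw [dotProduct_add, dotProduct_sum_smul]
    have := Finset.sum_nonpos fun j (_ : j ∈ Finset.univ) =>
      mul_nonpos_of_nonneg_of_nonpos (Int.fract_nonneg (c j)) (hra j k)
    linarith [hy k]
  · rw [hx']
    simp only [Pi.add_apply, Finset.sum_apply, Pi.smul_apply, smul_eq_mul]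
    exact (hxI i hi).add (IsInt.sum fun j => IsInt.mul ⟨-⌊c j⌋, by simp⟩ (hr j i))
  · rw [← abs_le]
    refine le_trans ?_ (Int.le_ceil _)
    refine (abs_add_le _ _).trans (add_le_add (hyC i) ?_)
    simp only [Finset.sum_apply, Pi.smul_apply, smul_eq_mul]
    calc |∑ j, Int.fract (c j) * r j i| ≤ ∑ j, |Int.fract (c j) * r j i| :=
          Finset.abs_sum_le_sum_abs _ _
      _ ≤ ∑ j, |r j i| := Finset.sum_le_sum fun j _ => by
          rw [abs_mul, abs_of_nonneg (Int.fract_nonneg _)]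
          exact mul_le_of_le_one_left (abs_nonneg _) (Int.fract_lt_one _).le
      _ ≤ _ := Finset.single_le_sum (f := fun i => ∑ j, |r j i|)
          (fun i _ => Finset.sum_nonneg fun j _ => abs_nonneg _) (Finset.mem_univ i)
  · rw [hx']
    simp [hLr]

/-- Fixing the values of the integer coordinates in `[-N, N]` leaves a polyhedron, and there are
finitely many choices. The choice function `z` is defined on all of `ι` but constrains only `I`. -/
theorem isPolyUnion_of_bounded_mixedInteger {κ : Type} [Finite κ] {a : κ → ι → ℝ} {β : κ → ℝ}
    (ha : ∀ k i, a k i ∈ K) (hβ : ∀ k, β k ∈ K) (I : Set ι) (N : ℤ) :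
    IsPolyUnion K {x | ((∀ k, a k ⬝ᵥ x ≤ β k) ∧ ∀ i ∈ I, IsInt (x i)) ∧
      ∀ i, -(N : ℝ) ≤ x i ∧ x i ≤ N} := by
  have hint : ∀ z : ℤ, IsAff K (fun _ : ι → ℝ => (z : ℝ)) := fun z => .const (intCast_mem K z)
  convert IsPolyUnion.exists (K := K) (κ := ι → Set.Icc (-N) N) (q := fun _ => True)
    (fun z => (IsPoly.forall fun k => IsPoly.setOf_le (.linear (ha k)) (.const (hβ k))).and
      ((IsPoly.forall fun i => (IsPoly.setOf_le (hint N).neg (.coord i)).and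
        (.setOf_le (.coord i) (hint N))).and
      (.forall fun i => .imp (q := i ∈ I) fun _ => .setOf_eq (.coord i) (hint (z i))))) using 1
  ext x
  simp only [Set.mem_ofPred_eq, true_and]
  constructor
  · rintro ⟨⟨h1, h2⟩, h3⟩
    choose! z hz using h2
    -- Coordinates outside `I` get the default value `N`, which must lie in `[-N, N]`; for empty `ι`
    -- no default is needed.
    have hN : -N ≤ N ∨ IsEmpty ι := by
      by_contra! h
      obtain ⟨h, ⟨i⟩⟩ := h
      have h4 : -(N : ℝ) ≤ N := (h3 i).1.trans (h3 i).2
      exact absurd (by exact_mod_cast h4) (not_le.2 h)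
    have h4 : ∀ i, ∃ w : Set.Icc (-N) N, i ∈ I → x i = ((w : ℤ) : ℝ) := fun i => by
      by_cases hi : i ∈ I
      · refine ⟨⟨z i, ?_⟩, fun _ => hz i hi⟩
        have h5 := h3 i
        rw [hz i hi] at h5
        exact ⟨by exact_mod_cast h5.1, by exact_mod_cast h5.2⟩
      · exact ⟨⟨N, hN.resolve_right fun h => h.elim i, le_rfl⟩, fun h => absurd h hi⟩
    choose w hw using h4
    exact ⟨w, h1, h3, hw⟩
  · rintro ⟨z, h1, h3, h4⟩
    exact ⟨⟨h1, fun i hi => ⟨z i, h4 i hi⟩⟩, h3⟩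

theorem isPolyUnion_of_bounded_representable_mixedInteger {n : ℕ} {S : Set (Fin n → ℝ)}
    (hS : S ∈ (mixedIntegerSets rationals K).representable K n) (hb : Bornology.IsBounded S) :
    IsPolyUnion K S := by
  obtain ⟨m, _, L, ⟨p, A, b, I, hA, hb', rfl⟩, hL, rfl⟩ := hS
  obtain ⟨N, hN⟩ := exists_bounded_subset_image_eq (a := A) (β := b) hA I L.mulVecLin hb
  have h1 : (fun x => L *ᵥ x) '' {x | x ∈ polyhedron A b ∧ ∀ i ∈ I, IsInt (x i)} = _ := hN
  rw [h1]
  exact (isPolyUnion_of_bounded_mixedInteger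
    (fun k i => (bot_le : ⊥ ≤ K) (mem_bot_iff.2 (hA k i))) hb' I N).image (IsAff.mulVec hL .coord)

end MixedInteger

/-! ### Bounded unions as images of binary sets, and binary sets in each family. -/

/-- The points of a polyhedron in the nonnegative orthant whose coordinates with index in `I` are
binary. -/
def binarySet {ι : Type} (P : Set (ι → ℝ)) (I : Set ι) : Set (ι → ℝ) :=
  {x | x ∈ P ∧ (∀ i, 0 ≤ x i) ∧ ∀ i ∈ I, x i = 0 ∨ x i = 1}

section Lower
variable {K : Subfield ℝ}

/-- Bounded finite unions of polyhedra are linear images of binary sets with rational data. -/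
theorem exists_binarySet_of_isPolyUnion {n : ℕ} {S : Set (Fin n → ℝ)} (hS : IsPolyUnion K S)
    (hb : Bornology.IsBounded S) :
    ∃ (m : ℕ) (P : Set (Fin m → ℝ)) (I : Set (Fin m)) (L : Matrix (Fin n) (Fin m) ℝ),
      IsPoly ⊥ P ∧ (∀ i j, L i j ∈ K) ∧ S = (fun x => L *ᵥ x) '' binarySet P I := by
  classical
  obtain ⟨k, Q, hQ, rfl⟩ := hS
  choose m v t hv ht h using fun i => exists_generators_of_bounded (hQ i)
    (hb.subset (Set.subset_iUnion Q i))
  have ht' : ∀ i j, t i j ∈ (⊥ : Subfield ℝ) := fun i j => by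
    rcases ht i j with ⟨h, -⟩ | h <;> simp [h, zero_mem, one_mem]
  have htn : ∀ i j, 0 ≤ t i j := fun i j => by rcases ht i j with ⟨h, -⟩ | h <;> simp [h]
  let τ := (Σ i, Fin (m i)) ⊕ Fin k
  let e := Fintype.equivFin τ
  let lam : (Fin (Fintype.card τ) → ℝ) → ∀ i, Fin (m i) → ℝ := fun x i j => x (e (.inl ⟨i, j⟩))
  let z : (Fin (Fintype.card τ) → ℝ) → Fin k → ℝ := fun x i => x (e (.inr i))
  -- `lam x i` holds the weights on the generators of piece `i` and `z x i` selects that piece. All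
  -- coefficients of the constraints are 0 or 1, as `t i j` is; the generators appear only in the
  -- matrix.
  refine ⟨Fintype.card τ, {x | (∀ i, ∑ j, t i j * lam x i j = z x i) ∧ ∑ i, z x i = 1},
    Set.range fun i => e (.inr i),
    fun l p => Sum.elim (fun q : Σ i, Fin (m i) => v q.1 q.2 l) 0 (e.symm p), ?_, ?_, ?_⟩
  · exact (IsPoly.forall fun i => IsPoly.setOf_eq
      (.sum fun j => (IsAff.coord _).const_mul (ht' i j)) (.coord _)).and
      (.setOf_eq (.sum fun i => .coord _) .one)
  · intro l p
    change Sum.elim (fun q : Σ i, Fin (m i) => v q.1 q.2 l) 0 (e.symm p) ∈ K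
    rcases e.symm p with q | q
    exacts [hv _ _ _, K.zero_mem]
  · have hL : ∀ x : Fin (Fintype.card τ) → ℝ,
        (fun l p => Sum.elim (fun q : Σ i, Fin (m i) => v q.1 q.2 l) 0 (e.symm p) :
          Matrix (Fin n) (Fin (Fintype.card τ)) ℝ) *ᵥ x = ∑ i, ∑ j, lam x i j • v i j := by
      intro x
      ext l
      simp only [Matrix.mulVec, dotProduct]
      rw [← e.sum_comp]
      simp [τ, Fintype.sum_sum_type, Fintype.sum_sigma, lam, mul_comm]
    ext y
    simp only [Set.mem_iUnion, Set.mem_image, hL, binarySet, Set.mem_ofPred_eq, Set.mem_range,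
      forall_exists_index, forall_apply_eq_imp_iff]
    constructor
    · rintro ⟨i₀, hi₀⟩
      obtain ⟨c, hc, h1, rfl⟩ := (h i₀ y).1 hi₀
      let x : Fin (Fintype.card τ) → ℝ := fun p => Sum.elim
        (fun q : Σ i, Fin (m i) => if hq : q.1 = i₀ then c (hq ▸ q.2) else 0)
        (fun i => if i = i₀ then 1 else 0) (e.symm p)
      have hx0 : ∀ i ≠ i₀, ∀ j, lam x i j = 0 := fun i hi j => by simp [lam, x, hi]
      have hx1 : ∀ j, lam x i₀ j = c j := fun j => by simp [lam, x]
      have hz : ∀ i, z x i = if i = i₀ then 1 else 0 := fun i => by simp [z, x]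
      refine ⟨x, ⟨⟨fun i => ?_, by simp [hz]⟩, fun p => ?_, fun i => ?_⟩, ?_⟩
      · rw [hz]
        split_ifs with hi
        · subst hi
          simpa [hx1, mul_comm] using h1
        · simp [hx0 i hi]
      · obtain ⟨q | i, rfl⟩ := e.surjective p
        · by_cases hq : q.1 = i₀
          · simp [x, hq, hc]
          · simp [x, hq]
        · change 0 ≤ z x i
          rw [hz]
          split_ifs <;> simp
      · change z x i = 0 ∨ z x i = 1
        rw [hz]
        split_ifs <;> simp
      · rw [Finset.sum_eq_single i₀ (fun i _ hi => by simp [hx0 i hi]) (by simp)]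
        simp [hx1]
    · rintro ⟨x, ⟨⟨hsum, hone⟩, hpos, hbin⟩, rfl⟩
      obtain ⟨i₀, hi₀⟩ : ∃ i, z x i = 1 := by
        by_contra! hne
        have : ∀ i, z x i = 0 := fun i => (hbin i).resolve_right (hne i)
        simp [this] at hone
      have hz0 : ∀ i ≠ i₀, z x i = 0 := fun i hi => by
        rw [← Finset.add_sum_erase _ _ (Finset.mem_univ i₀), hi₀, add_eq_left,
          Finset.sum_eq_zero_iff_of_nonneg fun i _ => hpos _] at hone
        exact hone i (by simp [hi])
      refine ⟨i₀, (h i₀ _).2 ⟨lam x i₀, fun j => hpos _, ?_, ?_⟩⟩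
      · rw [← hi₀, ← hsum]
        exact Finset.sum_congr rfl fun j _ => mul_comm _ _
      -- An unselected piece contributes nothing: its points have total weight zero, and its
      -- remaining generators are zero vectors by boundedness.
      · refine Finset.sum_eq_single i₀ (fun i _ hi => Finset.sum_eq_zero fun j _ => ?_) (by simp)
        rcases ht i j with ⟨-, h0⟩ | h1
        · rw [h0, smul_zero]
        · have h2 := hsum i
          rw [hz0 i hi, Finset.sum_eq_zero_iff_of_nonneg fun j _ =>
            mul_nonneg (htn i j) (hpos _)] at h2
          have h3 := h2 j (Finset.mem_univ j)
          rw [h1, one_mul] at h3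
          exact smul_eq_zero_of_left h3 _

theorem mem_mixedIntegerSets_of_isPoly {K K' : Subfield ℝ} (hK : K ≤ K') {n : ℕ}
    {P : Set (Fin n → ℝ)} (hP : IsPoly K P) (I : Set (Fin n)) :
    {x | x ∈ P ∧ ∀ i ∈ I, IsInt (x i)} ∈ mixedIntegerSets K K' n := by
  obtain ⟨m, A, b, hA, hb, rfl⟩ := hP
  exact ⟨m, A, b, I, hA, fun i => hK (hb i), rfl⟩

variable {n : ℕ} {P : Set (Fin n → ℝ)}

theorem binarySet_mem_mixedIntegerSets {K K' : Subfield ℝ} (hK : K ≤ K') (hP : IsPoly K P)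
    (I : Set (Fin n)) : binarySet P I ∈ mixedIntegerSets K K' n := by
  convert mem_mixedIntegerSets_of_isPoly hK (hP.and ((IsPoly.forall fun i =>
    IsPoly.setOf_le .zero (.coord i)).and (.forall fun i => .imp (q := i ∈ I) fun _ =>
      .setOf_le (.coord i) .one))) I using 1
  ext x
  simp only [binarySet, Set.mem_ofPred_eq]
  constructor
  · rintro ⟨h1, h2, h3⟩
    refine ⟨⟨h1, h2, fun i hi => ?_⟩, fun i hi => ?_⟩
    · rcases h3 i hi with h | h <;> simp [h]
    · rcases h3 i hi with h | h
      exacts [⟨0, by simp [h]⟩, ⟨1, by simp [h]⟩]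
  · rintro ⟨⟨h1, h2, h3⟩, h4⟩
    refine ⟨h1, h2, fun i hi => ?_⟩
    obtain ⟨z, hz⟩ := h4 i hi
    have h5 := h2 i
    have h6 := h3 i hi
    rw [hz] at h5 h6 ⊢
    norm_cast at h5 h6 ⊢
    lia

theorem binarySet_mem_lcSets (hP : IsPoly K P) (I : Set (Fin n)) :
    binarySet P I ∈ lcSets K n := by
  classical
  obtain ⟨m, A, b, hA, hb, rfl⟩ := hP
  -- Complementarity reads `x i * (1 - x i) = 0` for `i ∈ I` and is void elsewhere.
  refine ⟨m, Matrix.diagonal fun i => if i ∈ I then -1 else 0, fun i => if i ∈ I then 1 else 0,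
    A, b, fun i j => ?_, fun i => ?_, hA, hb, ?_⟩
  · rw [Matrix.diagonal_apply]
    split_ifs
    exacts [K.neg_mem K.one_mem, K.zero_mem, K.zero_mem]
  · beta_reduce
    split_ifs
    exacts [K.one_mem, K.zero_mem]
  · ext x
    have hq : ∀ i, (((Matrix.diagonal fun i => if i ∈ I then (-1 : ℝ) else 0) *ᵥ x +
        (fun i => if i ∈ I then (1 : ℝ) else 0) : Fin n → ℝ)) i = if i ∈ I then 1 - x i else 0 := fun i => by
      rw [Pi.add_apply, Matrix.mulVec_diagonal]
      split_ifs <;> ring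
    simp only [binarySet, Set.mem_ofPred_eq, Pi.le_def, hq, dotProduct, Pi.zero_apply]
    constructor
    · rintro ⟨h1, h2, h3⟩
      refine ⟨h2, fun i => ?_, Finset.sum_eq_zero fun i _ => ?_, h1⟩ <;> split_ifs with hi
      · rcases h3 i hi with h | h <;> simp [h]
      · exact le_rfl
      · rcases h3 i hi with h | h <;> simp [h]
      · simp
    · rintro ⟨h1, h2, h3, h4⟩
      refine ⟨h4, h1, fun i hi => ?_⟩
      rw [Finset.sum_eq_zero_iff_of_nonneg fun i _ => mul_nonneg (h1 i) (h2 i)] at h3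
      have := h3 i (Finset.mem_univ i)
      rw [if_pos hi, mul_eq_zero, sub_eq_zero] at this
      exact this.imp_right Eq.symm

theorem isPolyhedralConvex_max {f g : (Fin n → ℝ) → ℝ} (hf : IsAff K f) (hg : IsAff K g) :
    IsPolyhedralConvex K fun x => max (f x) (g x) := by
  obtain ⟨a, β, ha, hβ, h⟩ := hf
  obtain ⟨a', β', ha', hβ', h'⟩ := hg
  refine ⟨2, ![a, a'], ![-β, -β'], ?_, ?_, fun x => ?_⟩
  · simpa [Fin.forall_fin_two] using ⟨ha, ha'⟩
  · simpa [Fin.forall_fin_two] using ⟨hβ, hβ'⟩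
  · have : (Set.range fun j => ![a, a'] j ⬝ᵥ x - ![-β, -β'] j) = {f x, g x} := by
      ext y
      simp [Fin.exists_fin_two, h, h', eq_comm]
    rw [this]
    exact isGreatest_pair

theorem binarySet_mem_prcSets (hP : IsPoly K P) (I : Set (Fin n)) :
    binarySet P I ∈ prcSets K n := by
  classical
  obtain ⟨m, A, b, hA, hb, h⟩ := hP.and ((IsPoly.forall fun i =>
    IsPoly.setOf_le .zero (.coord i)).and (.forall fun i => .imp (q := i ∈ I) fun _ =>
      .setOf_le (.coord i) .one))
  -- With `0 ≤ x i ≤ 1`, `max (-x i) (x i - 1) ≥ 0` forces an endpoint; outside `I` the constraint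
  -- `max (-x i) 0 ≥ 0` is void.
  refine ⟨n, m, A, b, fun i x => max (-x i) (if i ∈ I then x i - 1 else 0), hA, hb,
    fun i => isPolyhedralConvex_max (IsAff.coord i).neg ?_, ?_⟩
  · split_ifs
    exacts [(IsAff.coord i).sub .one, .zero]
  · ext x
    have h1 : x ∈ {x | x ∈ P ∧ (∀ i, 0 ≤ x i) ∧ ∀ i, i ∈ I → x i ≤ 1} ↔ A *ᵥ x ≤ b :=
      Set.ext_iff.1 h x
    simp only [Set.mem_ofPred_eq] at h1
    simp only [binarySet, Set.mem_ofPred_eq, ← h1, le_max_iff]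
    constructor
    · rintro ⟨h1, h2, h3⟩
      refine ⟨⟨h1, h2, fun i hi => ?_⟩, fun i => ?_⟩
      · rcases h3 i hi with h | h <;> simp [h]
      · split_ifs with hi
        · rcases h3 i hi with h | h <;> simp [h]
        · simp
    · rintro ⟨⟨h1, h2, h3⟩, h4⟩
      refine ⟨h1, h2, fun i hi => ?_⟩
      have := h4 i
      rw [if_pos hi] at this
      exact this.imp (fun h => le_antisymm (by linarith) (h2 i))
        (fun h => le_antisymm (h3 i hi) (by linarith))

theorem mem_representable_of_image {T : SetFamily} {S₀ : Set (Fin n → ℝ)}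
    (hS : S₀ ∈ T.representable K n) {m : ℕ} {L : Matrix (Fin m) (Fin n) ℝ}
    (hL : ∀ i j, L i j ∈ K) : (fun x => L *ᵥ x) '' S₀ ∈ T.representable K m := by
  obtain ⟨p, T₀, L', h, hL', rfl⟩ := hS
  refine ⟨p, T₀, L * L', h, fun i j => ?_, ?_⟩
  · rw [Matrix.mul_apply]
    exact K.sum_mem fun k _ => K.mul_mem (hL i k) (hL' k j)
  · simp [Set.image_image]

theorem mem_representable_of_mem {T : SetFamily} {S₀ : Set (Fin n → ℝ)} (hS : S₀ ∈ T n) :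
    S₀ ∈ T.representable K n := by
  refine ⟨n, S₀, 1, hS, fun i j => ?_, by simp⟩
  rw [Matrix.one_apply]
  split_ifs
  exacts [K.one_mem, K.zero_mem]

/-- A continuous bilevel linear set whose two levels are given by polyhedra. -/
theorem mem_cblSets_of_isPoly {nl nf : ℕ} {U W : Set (Fin nl ⊕ Fin nf → ℝ)} (hU : IsPoly K U)
    (hW : IsPoly K W) {f : Fin nf → ℝ} (hf : ∀ i, f i ∈ K) :
    {z : Fin (nl + nf) → ℝ |
      Sum.elim (fun i => z (Fin.castAdd nf i)) (fun i => z (Fin.natAdd nl i)) ∈ U ∧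
      Sum.elim (fun i => z (Fin.castAdd nf i)) (fun i => z (Fin.natAdd nl i)) ∈ W ∧
      ∀ y', Sum.elim (fun i => z (Fin.castAdd nf i)) y' ∈ W →
        f ⬝ᵥ y' ≤ f ⬝ᵥ fun i => z (Fin.natAdd nl i)} ∈ cblSets K (nl + nf) := by
  obtain ⟨mu, a, b, ha, hb, rfl⟩ := hU
  obtain ⟨mw, c, g, hc, hg, rfl⟩ := hW
  have key : ∀ (a : Fin nl ⊕ Fin nf → ℝ) x y, a ⬝ᵥ Sum.elim x y =
      (fun i => a (.inl i)) ⬝ᵥ x + (fun i => a (.inr i)) ⬝ᵥ y := fun a x y => by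
    simp [dotProduct, Fintype.sum_sum_type]
  refine ⟨nl, nf, mu, mw, rfl, fun i j => a i (.inl j), fun i j => a i (.inr j), b, f,
    fun i j => c i (.inl j), fun i j => c i (.inr j), g, fun i j => ha _ _, fun i j => ha _ _, hb,
    hf, fun i j => hc _ _, fun i j => hc _ _, hg, ?_⟩
  ext z
  simp only [Set.mem_ofPred_eq, key, InBilevelSet, IsLowerOptimal, Set.mem_empty_iff_false,
    false_imp_iff, implies_true, and_true, forall_const, Pi.le_def, Pi.add_apply, Matrix.mulVec,
    le_sub_iff_add_le', Fin.cast_eq_self]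

/-- The follower maximizes `∑ y i` subject to `y i ≤ x i` and `y i ≤ 1 - x i`, so `y i = min (x i)
(1 - x i)`. The leader demands `y i = 0` on `I`, and the linear map projects `y` away. -/
theorem binarySet_mem_representable_cblSets (hP : IsPoly K P) (I : Set (Fin n)) :
    binarySet P I ∈ (cblSets K).representable K n := by
  classical
  have hU : IsPoly K {w : Fin n ⊕ Fin n → ℝ | (fun i => w (.inl i)) ∈ P ∧
      (∀ i, 0 ≤ w (.inl i)) ∧ ∀ i, i ∈ I → w (.inr i) = 0} :=
    (hP.preimage fun i => .coord _).and ((IsPoly.forall fun i =>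
      IsPoly.setOf_le .zero (.coord _)).and (.forall fun i => .imp fun _ =>
      .setOf_eq (.coord _) .zero))
  have hW : IsPoly K {w : Fin n ⊕ Fin n → ℝ | (∀ i, w (.inr i) ≤ w (.inl i)) ∧
      ∀ i, w (.inr i) ≤ 1 - w (.inl i)} :=
    (IsPoly.forall fun i => IsPoly.setOf_le (.coord _) (.coord _)).and
      (.forall fun i => .setOf_le (.coord _) (.sub .one (.coord _)))
  refine ⟨n + n, _, fun i j => if j = Fin.castAdd n i then 1 else 0,
    mem_cblSets_of_isPoly hU hW (f := 1) (fun _ => K.one_mem), fun i j => ?_, ?_⟩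
  · beta_reduce
    split_ifs
    exacts [K.one_mem, K.zero_mem]
  · have hL : ∀ z : Fin (n + n) → ℝ,
        (fun i j => if j = Fin.castAdd n i then 1 else 0 : Matrix (Fin n) (Fin (n + n)) ℝ) *ᵥ z =
          fun i => z (Fin.castAdd n i) := fun z => by
      ext i
      simp [Matrix.mulVec, dotProduct]
    ext x
    simp only [binarySet, Set.mem_image, hL, Set.mem_ofPred_eq, Sum.elim_inl, Sum.elim_inr,
      one_dotProduct]
    constructor
    · rintro ⟨h1, h2, h3⟩
      refine ⟨Fin.append x fun i => min (x i) (1 - x i), ⟨⟨?_, ?_, ?_⟩, ⟨?_, ?_⟩, ?_⟩, ?_⟩ <;>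
        simp only [Fin.append_left, Fin.append_right]
      · exact h1
      · exact h2
      · intro i hi
        rcases h3 i hi with h | h <;> simp [h]
      · exact fun i => min_le_left _ _
      · exact fun i => min_le_right _ _
      · exact fun y' hy' => Finset.sum_le_sum fun i _ => le_min (hy'.1 i) (hy'.2 i)
    · rintro ⟨z, ⟨⟨h1, h2, h3⟩, ⟨h4, h5⟩, h6⟩, rfl⟩
      refine ⟨h1, h2, fun i hi => ?_⟩
      have h7 := h6 (fun i => min (z (Fin.castAdd n i)) (1 - z (Fin.castAdd n i)))
        ⟨fun i => min_le_left _ _, fun i => min_le_right _ _⟩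
      -- Equal sums with termwise inequality force equality in every coordinate.
      have h8 := (Finset.sum_eq_sum_iff_of_le fun i _ => le_min (h4 i) (h5 i)).1
        (le_antisymm (Finset.sum_le_sum fun i _ => le_min (h4 i) (h5 i)) h7) i (Finset.mem_univ i)
      rw [h3 i hi] at h8
      rcases min_choice (z (Fin.castAdd n i)) (1 - z (Fin.castAdd n i)) with h | h <;> rw [h] at h8
      · exact .inl h8.symm
      · exact .inr (by linarith)

end Lower

/-! ### Combining the two inclusions. -/

section Equality
variable {K : Subfield ℝ}

/-- Representability is stable under linear images over `K`, so containing the rational binary sets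
is enough to obtain every bounded union. -/
theorem bounded_representable_eq {T : SetFamily}
    (hupper : ∀ n, ∀ S ∈ T.representable K n, Bornology.IsBounded S → IsPolyUnion K S)
    (hlower : ∀ (n : ℕ) (P : Set (Fin n → ℝ)) (I : Set (Fin n)), IsPoly ⊥ P →
      binarySet P I ∈ T.representable K n) :
    (T.representable K).bounded = (polyhedralUnions K).bounded := by
  ext n S
  refine ⟨fun ⟨hS, hb⟩ => ⟨hupper n S hS hb, hb⟩, fun ⟨hS, hb⟩ => ⟨?_, hb⟩⟩
  obtain ⟨m, P, I, L, hP, hL, rfl⟩ := exists_binarySet_of_isPolyUnion hS hb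
  exact mem_representable_of_image (hlower m P I hP) hL

variable (K)

theorem bounded_cblSets_eq :
    ((cblSets K).representable K).bounded = (polyhedralUnions K).bounded :=
  bounded_representable_eq
    (fun _ _ hS _ => isPolyUnion_of_mem_representable (fun _ _ => isPolyUnion_of_mem_cblSets) hS)
    fun _ _ I hP => binarySet_mem_representable_cblSets (hP.mono bot_le) I

theorem bounded_lcSets_eq :
    ((lcSets K).representable K).bounded = (polyhedralUnions K).bounded :=
  bounded_representable_eq
    (fun _ _ hS _ => isPolyUnion_of_mem_representable (fun _ _ => isPolyUnion_of_mem_lcSets) hS)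
    fun _ _ I hP => mem_representable_of_mem (binarySet_mem_lcSets (hP.mono bot_le) I)

theorem bounded_prcSets_eq :
    ((prcSets K).representable K).bounded = (polyhedralUnions K).bounded :=
  bounded_representable_eq
    (fun _ _ hS _ => isPolyUnion_of_mem_representable (fun _ _ => isPolyUnion_of_mem_prcSets) hS)
    fun _ _ I hP => mem_representable_of_mem (binarySet_mem_prcSets (hP.mono bot_le) I)

theorem coe_bot_eq_rationals : ((⊥ : Subfield ℝ) : Set ℝ) = rationals :=
  Set.ext fun _ => mem_bot_iff

theorem bounded_mixedIntegerSets_eq :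
    ((mixedIntegerSets rationals K).representable K).bounded = (polyhedralUnions K).bounded :=
  bounded_representable_eq
    (fun _ _ => isPolyUnion_of_bounded_representable_mixedInteger)
    fun _ _ I hP => mem_representable_of_mem
      (coe_bot_eq_rationals ▸ binarySet_mem_mixedIntegerSets bot_le hP I)

theorem bounded_families_eq :
    ((cblSets K).representable K).bounded = ((lcSets K).representable K).bounded ∧
      ((lcSets K).representable K).bounded = ((prcSets K).representable K).bounded ∧
      ((prcSets K).representable K).bounded = (polyhedralUnions K).bounded ∧
      (polyhedralUnions K).bounded
        = ((mixedIntegerSets rationals K).representable K).bounded :=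
  ⟨(bounded_cblSets_eq K).trans (bounded_lcSets_eq K).symm,
    (bounded_lcSets_eq K).trans (bounded_prcSets_eq K).symm, bounded_prcSets_eq K,
    (bounded_mixedIntegerSets_eq K).symm⟩

end Equality

end Representability

/-- For bounded sets, CBL-, LC- and PRC-representability, being a finite union of polyhedra, and
MILP-representability (the constraint matrix of the mixed-integer set being rational) agree: first
for real data and real linear maps, then for rational data and rational linear maps. -/
theorem corollary3p3 :
    (((cblSets Set.univ).representable Set.univ).bounded
        = ((lcSets Set.univ).representable Set.univ).bounded ∧
      ((lcSets Set.univ).representable Set.univ).bounded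
        = ((prcSets Set.univ).representable Set.univ).bounded ∧
      ((prcSets Set.univ).representable Set.univ).bounded
        = (polyhedralUnions Set.univ).bounded ∧
      (polyhedralUnions Set.univ).bounded
        = ((mixedIntegerSets rationals Set.univ).representable Set.univ).bounded) ∧
    (((cblSets rationals).representable rationals).bounded
        = ((lcSets rationals).representable rationals).bounded ∧
      ((lcSets rationals).representable rationals).bounded
        = ((prcSets rationals).representable rationals).bounded ∧
      ((prcSets rationals).representable rationals).bounded
        = (polyhedralUnions rationals).bounded ∧
      (polyhedralUnions rationals).bounded
        = ((mixedIntegerSets rationals rationals).representable rationals).bounded) := by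
  have h₁ := bounded_families_eq ⊤
  have h₂ := bounded_families_eq ⊥
  rw [Subfield.coe_top] at h₁
  rw [coe_bot_eq_rationals] at h₂
  exact ⟨h₁, h₂⟩
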